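/- In a directed graph, let $d(x,y)\in\mathbb{N}\cup\{\infty\}$ be the length of a shortest directed path from $x$ to $y$ (and $\infty$ if there is none). A directed path is geodesic if its length is the distance from its start to its end. A geodesic triangle is a triple $(p,q,r)$ of geodesics such that $p$ ends where $q$ starts, $r$ starts where $p$ starts, and $r$ ends where $q$ ends. For a real number $\delta\ge 0$ it is $\delta$-thin if each side $x$ is contained in the union of the out-balls $\{y: d(z,y)\le\delta\}$ around the vertices $z$ of the other side meeting the start of $x$ and the in-balls $\{y: d(y,z)\le\delta\}$ around the vertices $z$ of the other side meeting the end of $x$. A monoid $M$ is strongly $\delta$-hyperbolic with respect to a finite generating set $S$ if all geodesic triangles of its right Cayley graph (vertex set $M$, edges $m\to ms$ for $s\in S$) are $\delta$-thin. **Theorem.** Let $M$ be a left cancellative monoid that is strongly $\delta$-hyperbolic with respect to some finite generating set. Then the word problem of $M$ lies in $\mathcal{NP}$. Precisely, let $A$ be any finite alphabet whose letters represent elements that generate $M$. Then: 1. there are a finite set $R$ of relations such that $\langle A\mid R\rangle$ is a presentation of $M$ and a polynomial $p$ bounding its Dehn function: any two words $u,v\in A^*$ that represent the same element of $M$ can be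 transformed into each other by at most $p(|u|+|v|)$ applications of relations of $R$; 2. the language $\{u\#v : u,v\in A^*,\ u=v \text{ in } M\}$ over the alphabet $A\cup\{\#\}$ is in $\mathcal{NP}$. -/

import Mathlib

open scoped NNReal ENNReal

/-! ### Directed graphs as semimetric spaces -/

namespace Digraph

variable {V : Type*} (G : Digraph V)

/-- Directed paths `[x₀, …, xₙ]`, with an edge from `xᵢ` to `xᵢ₊₁`. A path has a `length` (its
number of edges, possibly zero), a start `head` and an end `last`; `x ∈ p` says that the vertex `x`
lies on `p`. -/
abbrev Path : Type _ := RelSeries {e : V × V | G.Adj e.1 e.2}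

/-- The length of a shortest directed path from `u` to `v`, or `∞` if there is none. -/
noncomputable def pathDist (u v : V) : ℝ≥0∞ :=
  ⨅ (p : G.Path) (_ : p.head = u ∧ p.last = v), (p.length : ℝ≥0∞)

/-- A path is geodesic if its length is the distance from its start to its end. -/
def IsGeodesic (p : G.Path) : Prop := (p.length : ℝ≥0∞) = G.pathDist p.head p.last

/-- The union of the out-balls of radius `r` around the points of `S`. -/
def outBall (r : ℝ≥0) (S : Set V) : Set V := {y | ∃ x ∈ S, G.pathDist x y ≤ (r : ℝ≥0∞)}

/-- The union of the in-balls of radius `r` around the points of `S`. -/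
def inBall (r : ℝ≥0) (S : Set V) : Set V := {y | ∃ x ∈ S, G.pathDist y x ≤ (r : ℝ≥0∞)}

/-- The set of vertices of a path. -/
def Path.verts {G : Digraph V} (p : G.Path) : Set V := {x | x ∈ p}

/-- `(p, q, r)` is a geodesic triangle: three geodesics, such that `p` and `q` are composable and
`p ∘ q` is parallel to `r`. -/
structure IsGeodesicTriangle (p q r : G.Path) : Prop where
  geodesic₁ : G.IsGeodesic p
  geodesic₂ : G.IsGeodesic q
  geodesic₃ : G.IsGeodesic r
  composable : p.last = q.head
  start_eq : p.head = r.head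
  end_eq : q.last = r.last

/-- Each side is contained in the union of the `δ`-out-balls around the points of the side that
meets its start and the `δ`-in-balls around the points of the side that meets its end. -/
structure IsThin (δ : ℝ≥0) (p q r : G.Path) : Prop where
  third : Path.verts r ⊆ G.outBall δ (Path.verts p) ∪ G.inBall δ (Path.verts q)
  first : Path.verts p ⊆ G.outBall δ (Path.verts r) ∪ G.inBall δ (Path.verts q)
  second : Path.verts q ⊆ G.outBall δ (Path.verts p) ∪ G.inBall δ (Path.verts r)

/-- A directed graph is strongly `δ`-hyperbolic if all its geodesic triangles are `δ`-thin. -/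
def StronglyHyperbolic (δ : ℝ≥0) : Prop :=
  ∀ p q r : G.Path, G.IsGeodesicTriangle p q r → G.IsThin δ p q r

end Digraph

/-- The right Cayley graph of a monoid: an edge from `m` to `m * s` for all `m` and all `s ∈ S`. -/
def rightCayleyGraph {M : Type*} [Monoid M] (S : Set M) : Digraph M where
  Adj m m' := ∃ s ∈ S, m * s = m'

/-! ### Words, relations and presentations -/

/-- The element represented by a word over an alphabet `α` whose letters stand for elements. -/
def evalWord {M α : Type*} [Monoid M] (g : α → M) (w : List α) : M := (w.map g).prod

/-- `v` arises from `u` by one application of a relation of `R`, in either direction. -/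
def RelationStep {α : Type*} (R : Set (List α × List α)) (u v : List α) : Prop :=
  ∃ x y l r : List α, ((l, r) ∈ R ∨ (r, l) ∈ R) ∧ u = x ++ l ++ y ∧ v = x ++ r ++ y

/-- `u` can be transformed into `v` by exactly `k` successive applications of relations of `R`. -/
def DerivesIn {α : Type*} (R : Set (List α × List α)) (k : ℕ) (u v : List α) : Prop :=
  ∃ f : ℕ → List α, f 0 = u ∧ f k = v ∧ ∀ i < k, RelationStep R (f i) (f (i + 1))

/-- `M` is presented by `⟨α | R⟩` through `g : α → M`: the letters generate `M`, and two words
represent the same element exactly if they can be transformed into each other by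
finitely many applications of relations of `R`. -/
structure IsMonoidPresentation {M α : Type*} [Monoid M] (g : α → M)
    (R : Set (List α × List α)) : Prop where
  generates : Submonoid.closure (Set.range g) = ⊤
  eq_iff : ∀ u v : List α, evalWord g u = evalWord g v ↔ ∃ k, DerivesIn R k u v

/-- The Dehn function of `⟨α | R⟩` is bounded above by the function `F`: any two words `u`, `v`
that are equivalent modulo `R` can be transformed into each other by at most `F (|u| + |v|)`
applications of relations of `R`. -/
def DehnFunctionLE {α : Type*} (R : Set (List α × List α)) (F : ℕ → ℕ) : Prop :=
  ∀ (n : ℕ) (u v : List α), (∃ k, DerivesIn R k u v) → u.length + v.length ≤ n →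
    ∃ k ≤ F n, DerivesIn R k u v

/-- The word problem with respect to the generators `g`: the language of all `u # v` with words
`u` and `v` that represent the same element. The separator `#` is `none`. -/
def wordProblem {M α : Type*} [Monoid M] (g : α → M) : Language (Option α) :=
  {w | ∃ u v : List α, w = u.map some ++ [none] ++ v.map some ∧ evalWord g u = evalWord g v}

/-! ### The class NP -/

/-- A language over an alphabet `α` is in NP if it has a verifier `V`, computed in polynomial time
by a Turing machine, and a polynomial `p` such that `w` is in the language exactly if `V` accepts
`w` with some certificate of length at most `p (|w|)` over the finite alphabet `γ`. -/
def InNP {α : Type} (L : Language α) : Prop :=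
  ∃ (γ : Type) (_ : Finite γ) (V : List α × List γ → Bool) (p : Polynomial ℕ),
    Nonempty (Turing.TM2ComputableInPolyTime
      (Computability.encodingProd (Computability.encodingList α)
        (Computability.encodingList γ)).encode
      Computability.encodingBoolBool.encode V) ∧
    ∀ w : List α, w ∈ L ↔ ∃ c : List γ, c.length ≤ p.eval w.length ∧ V (w, c) = true

/-!
A word over the hyperbolic generating set `S` is a path in the Cayley graph. By left cancellation
distances do not depend on the base point, and two short paths with the same start and the same end
are labelled by words with the same value; so a cell of bounded size costs one relation from the
finite set `shortRelations` of all valid relations between words of bounded length.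

*Dehn function.* The basic estimate, `ThinWords.derivesWithin_of_short`, concerns a triangle with
one long geodesic side `x` and two short sides, `x e = f`. Thinness says that a vertex of `x` is
close after a vertex of `f`, which happens only near the start of `x` since `x` is geodesic, or that
it leads to `e`, and hence to the end of the triangle, by a short word. These short words cut the
triangle into at most `|x| + 1` bounded cells. In a geodesic triangle `(p, q, r)` with `|q| ≤ 1`,
all vertices of `r` but a bounded number at its end are reached by short words from vertices of `p`.
The words for consecutive vertices of `r` may leave `p` at points that are far apart, and in either
order, but the region between them is a triangle of the previous kind
(`ThinWords.derivesWithin_take`), so `(p, q, r)` costs quadratically many relations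
(`ThinWords.derivesWithin_triangle`). A word is transformed into a geodesic letter by letter, one
such triangle for each letter (`ThinWords.derivesWithin_geodesic`), which gives a cubic Dehn
function. A change of generators preserves a polynomial bound (`ThinWords.exists_presentation`).

*Membership in NP.* A certificate for `u # v` is a program that transforms `u` into `v` by moving a
cursor and replacing subwords by other words of bounded length with the same value, and finally
compares the result with `v`. It is executed by an automaton (`Verifier.automaton`) that has three
stacks and reads one symbol of `u # v` and the certificate at a time. An instruction never makes two
words equal in `M` that were not (`Verifier.step_sound`), and conversely a derivation of polynomial
length is simulated by a program of polynomial length (`Verifier.reaches_of_derivesIn`). Such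
automata are simulated by stack Turing machines in linear time
(`StackAutomaton.computableInPolyTime`).
-/

/-! ### Derivations of bounded length -/

section Words

variable {M α : Type*} [Monoid M] (g : α → M)

@[simp] theorem evalWord_nil : evalWord g [] = 1 := rfl

@[simp] theorem evalWord_cons (a : α) (w : List α) :
    evalWord g (a :: w) = g a * evalWord g w := by
  simp [evalWord]

@[simp] theorem evalWord_append (u v : List α) :
    evalWord g (u ++ v) = evalWord g u * evalWord g v := by
  simp [evalWord]

theorem exists_evalWord_eq (h : Submonoid.closure (Set.range g) = ⊤) (m : M) :
    ∃ w, evalWord g w = m := by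
  have hm : m ∈ Submonoid.closure (Set.range g) := h ▸ Submonoid.mem_top m
  induction hm using Submonoid.closure_induction with
  | mem x hx => obtain ⟨a, rfl⟩ := hx; exact ⟨[a], by simp⟩
  | one => exact ⟨[], rfl⟩
  | mul x y _ _ ihx ihy =>
    obtain ⟨u, rfl⟩ := ihx
    obtain ⟨v, rfl⟩ := ihy
    exact ⟨u ++ v, by simp⟩

theorem evalWord_flatMap {β : Type*} {h : β → M} {f : α → List β}
    (hf : ∀ a, evalWord h (f a) = g a) (w : List α) :
    evalWord h (w.flatMap f) = evalWord g w := by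
  induction w with
  | nil => simp
  | cons a w ih => simp [hf, ih]

theorem length_flatMap_le {β : Type*} {f : α → List β} {C : ℕ} (hf : ∀ a, (f a).length ≤ C)
    (w : List α) : (w.flatMap f).length ≤ C * w.length := by
  induction w with
  | nil => simp
  | cons a w ih =>
    have := hf a
    simp only [List.flatMap_cons, List.length_append, List.length_cons]
    lia

variable {g}

theorem RelationStep.evalWord_eq {R : Set (List α × List α)}
    (hR : ∀ x ∈ R, evalWord g x.1 = evalWord g x.2) {u v : List α} (h : RelationStep R u v) :
    evalWord g u = evalWord g v := by
  obtain ⟨x, y, l, r, h, rfl, rfl⟩ := h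
  have : evalWord g l = evalWord g r := by
    rcases h with h | h
    · exact hR _ h
    · exact (hR _ h).symm
  simp [this]

theorem DerivesIn.evalWord_eq {R : Set (List α × List α)}
    (hR : ∀ x ∈ R, evalWord g x.1 = evalWord g x.2) {k : ℕ} {u v : List α}
    (h : DerivesIn R k u v) : evalWord g u = evalWord g v := by
  obtain ⟨f, rfl, rfl, h⟩ := h
  induction k with
  | zero => rfl
  | succ k ih =>
    exact (ih fun i hi => h i (by omega)).trans ((h k (by omega)).evalWord_eq hR)

end Words

section Derivations

variable {α : Type*} {R : Set (List α × List α)}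

theorem RelationStep.symm {u v : List α} (h : RelationStep R u v) : RelationStep R v u := by
  obtain ⟨x, y, l, r, h, rfl, rfl⟩ := h
  exact ⟨x, y, r, l, h.symm, rfl, rfl⟩

/-- `u` can be transformed into `v` by at most `N` applications of relations of `R`. -/
def DerivesWithin (R : Set (List α × List α)) (N : ℕ) (u v : List α) : Prop :=
  ∃ k ≤ N, DerivesIn R k u v

namespace DerivesWithin

theorem refl (u : List α) (N : ℕ) : DerivesWithin R N u u :=
  ⟨0, N.zero_le, fun _ => u, rfl, rfl, fun i hi => absurd hi i.not_lt_zero⟩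

theorem mono {N N' : ℕ} {u v : List α} (h : DerivesWithin R N u v) (hN : N ≤ N') :
    DerivesWithin R N' u v :=
  let ⟨k, hk, h⟩ := h
  ⟨k, hk.trans hN, h⟩

theorem single {u v : List α} (h : RelationStep R u v) : DerivesWithin R 1 u v :=
  ⟨1, le_rfl, fun i => if i = 0 then u else v, by simp, by simp, fun i hi => by
    obtain rfl : i = 0 := by omega
    simpa using h⟩

theorem symm {N : ℕ} {u v : List α} (h : DerivesWithin R N u v) : DerivesWithin R N v u := by
  obtain ⟨k, hk, f, hu, hv, h⟩ := h
  refine ⟨k, hk, fun i => f (k - i), by simpa using hv, by simpa using hu, fun i hi => ?_⟩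
  have := (h (k - (i + 1)) (by omega)).symm
  rwa [show k - (i + 1) + 1 = k - i by omega] at this

theorem trans {N N' : ℕ} {u v w : List α} (h : DerivesWithin R N u v)
    (h' : DerivesWithin R N' v w) : DerivesWithin R (N + N') u w := by
  obtain ⟨k, hk, f, hu, hv, h⟩ := h
  obtain ⟨k', hk', f', hv', hw, h'⟩ := h'
  refine ⟨k + k', by omega, fun i => if i < k then f i else f' (i - k), ?_, by simpa using hw,
    fun i hi => ?_⟩
  · by_cases h0 : 0 < k
    · simpa [h0] using hu
    · obtain rfl : k = 0 := by omega
      simp [hv', ← hv, hu]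
  · by_cases h1 : i + 1 < k
    · simpa [h1, show i < k by omega] using h i (by omega)
    · by_cases h2 : i < k
      · obtain rfl : k = i + 1 := by omega
        have := h i (by omega)
        simpa [hv', ← hv] using this
      · have := h' (i - k) (by omega)
        simpa [h1, h2, show i - k + 1 = i + 1 - k by omega] using this

theorem map {β : Type*} {R' : Set (List β × List β)} {F : List α → List β}
    (hF : ∀ u v, RelationStep R u v → RelationStep R' (F u) (F v)) {N : ℕ} {u v : List α}
    (h : DerivesWithin R N u v) : DerivesWithin R' N (F u) (F v) := by
  obtain ⟨k, hk, f, rfl, rfl, h⟩ := h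
  exact ⟨k, hk, F ∘ f, rfl, rfl, fun i hi => hF _ _ (h i hi)⟩

theorem append_left {N : ℕ} {u v : List α} (h : DerivesWithin R N u v) (x : List α) :
    DerivesWithin R N (x ++ u) (x ++ v) :=
  h.map (F := fun u => x ++ u) <| by
    rintro _ _ ⟨y, z, l, r, h, rfl, rfl⟩
    exact ⟨x ++ y, z, l, r, h, by simp, by simp⟩

theorem append_right {N : ℕ} {u v : List α} (h : DerivesWithin R N u v) (x : List α) :
    DerivesWithin R N (u ++ x) (v ++ x) :=
  h.map (F := fun u => u ++ x) <| by
    rintro _ _ ⟨y, z, l, r, h, rfl, rfl⟩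
    exact ⟨y, z ++ x, l, r, h, by simp, by simp⟩

end DerivesWithin

/-- All relations between words of length at most `K` that hold in `M`. -/
def shortRelations {M : Type*} [Monoid M] (g : α → M) (K : ℕ) : Set (List α × List α) :=
  {x | x.1.length ≤ K ∧ x.2.length ≤ K ∧ evalWord g x.1 = evalWord g x.2}

theorem finite_shortRelations {M : Type*} [Monoid M] [Finite α] (g : α → M) (K : ℕ) :
    (shortRelations g K).Finite :=
  ((List.finite_length_le α K).prod (List.finite_length_le α K)).subset
    fun _ hx => ⟨hx.1, hx.2.1⟩

theorem DerivesWithin.of_short {M : Type*} [Monoid M] {g : α → M} {K : ℕ} {u v : List α}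
    (hu : u.length ≤ K) (hv : v.length ≤ K) (h : evalWord g u = evalWord g v) :
    DerivesWithin (shortRelations g K) 1 u v :=
  .single ⟨[], [], u, v, Or.inl ⟨hu, hv, h⟩, by simp, by simp⟩

/-- A substitution of words of length at most `C` for letters maps short relations to short
relations. -/
theorem DerivesWithin.flatMap {M β : Type*} [Monoid M] {g : α → M} {h : β → M}
    {f : α → List β} (hf : ∀ a, evalWord h (f a) = g a) {C K K' : ℕ}
    (hC : ∀ a, (f a).length ≤ C) (hK : C * K ≤ K') {N : ℕ} {u v : List α}
    (huv : DerivesWithin (shortRelations g K) N u v) :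
    DerivesWithin (shortRelations h K') N (u.flatMap f) (v.flatMap f) :=
  huv.map (F := fun u => u.flatMap f) <| by
    have key : ∀ x ∈ shortRelations g K, (x.1.flatMap f, x.2.flatMap f) ∈ shortRelations h K' :=
      fun x hx => ⟨(length_flatMap_le hC _).trans ((Nat.mul_le_mul_left C hx.1).trans hK),
        (length_flatMap_le hC _).trans ((Nat.mul_le_mul_left C hx.2.1).trans hK), by
          rw [evalWord_flatMap g hf, evalWord_flatMap g hf, hx.2.2]⟩
    rintro _ _ ⟨x, y, l, r, h, rfl, rfl⟩
    exact ⟨x.flatMap f, y.flatMap f, l.flatMap f, r.flatMap f,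
      h.imp (fun h => key _ h) (fun h => key _ h), by simp, by simp⟩

end Derivations

/-! ### Geodesics in the right Cayley graph -/

section Cayley

variable {M : Type*} [Monoid M] {S : Set M}

/-- The element represented by a word over the generating set `S`. -/
abbrev evalGen (w : List S) : M := evalWord (Subtype.val : S → M) w

theorem evalGen_append (u v : List S) : evalGen (u ++ v) = evalGen u * evalGen v :=
  evalWord_append _ u v

/-- A word is geodesic if no shorter word represents the same element. -/
def IsGeodesicWord (w : List S) : Prop :=
  ∀ w' : List S, evalGen w' = evalGen w → w.length ≤ w'.length

theorem exists_isGeodesicWord (hgen : Submonoid.closure S = ⊤) (m : M) :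
    ∃ w : List S, IsGeodesicWord w ∧ evalGen w = m := by
  classical
  have h : ∃ n, ∃ w : List S, w.length = n ∧ evalGen w = m := by
    obtain ⟨w, hw⟩ := exists_evalWord_eq (Subtype.val : S → M) (by simpa using hgen) m
    exact ⟨_, w, rfl, hw⟩
  obtain ⟨w, hl, hw⟩ := Nat.find_spec h
  exact ⟨w, fun w' h' => hl ▸ Nat.find_min' h ⟨w', rfl, h'.trans hw⟩, hw⟩

theorem evalGen_take_mul_drop (w : List S) (i : ℕ) :
    evalGen (w.take i) * evalGen (w.drop i) = evalGen w := by
  rw [← evalGen_append, List.take_append_drop]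

theorem IsGeodesicWord.of_append_left {u v : List S} (h : IsGeodesicWord (u ++ v)) :
    IsGeodesicWord u := fun w hw => by
  have := h (w ++ v) (by rw [evalGen_append, evalGen_append, hw])
  simpa using this

theorem IsGeodesicWord.of_append_right {u v : List S} (h : IsGeodesicWord (u ++ v)) :
    IsGeodesicWord v := fun w hw => by
  have := h (u ++ w) (by rw [evalGen_append, evalGen_append, hw])
  simpa using this

theorem IsGeodesicWord.take {w : List S} (h : IsGeodesicWord w) (i : ℕ) :
    IsGeodesicWord (w.take i) :=
  .of_append_left (v := w.drop i) (by simpa using h)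

theorem IsGeodesicWord.drop {w : List S} (h : IsGeodesicWord w) (i : ℕ) :
    IsGeodesicWord (w.drop i) :=
  .of_append_right (u := w.take i) (by simpa using h)

/-- The path in the Cayley graph that begins in `m` and is labelled by `w`. -/
def cayleyPath (m : M) (w : List S) : (rightCayleyGraph S).Path where
  length := w.length
  toFun i := m * evalGen (w.take i)
  step i := ⟨w[i.1], w[i.1].2, by
    have : w.take (i.1 + 1) = w.take i.1 ++ [w[i.1]] := List.take_succ_eq_append_getElem i.2
    simp only [Fin.val_succ, this, Fin.val_castSucc, evalGen, evalWord_append, evalWord_cons,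
      evalWord_nil, mul_one, mul_assoc]⟩

@[simp] theorem cayleyPath_head (m : M) (w : List S) : (cayleyPath m w).head = m := by
  simp [RelSeries.head, cayleyPath, evalGen]

@[simp] theorem cayleyPath_last (m : M) (w : List S) :
    (cayleyPath m w).last = m * evalGen w := by
  simp [RelSeries.last, cayleyPath, evalGen]

theorem mem_cayleyPath {m : M} {w : List S} {x : M} :
    x ∈ Digraph.Path.verts (cayleyPath m w) ↔ ∃ i ≤ w.length, m * evalGen (w.take i) = x := by
  constructor
  · rintro ⟨i, rfl⟩
    exact ⟨i.1, Nat.lt_succ_iff.1 i.2, rfl⟩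
  · rintro ⟨i, hi, rfl⟩
    exact ⟨⟨i, Nat.lt_succ_iff.2 hi⟩, rfl⟩

/-- Every path in the Cayley graph is labelled by a word. -/
theorem exists_word_of_path (p : (rightCayleyGraph S).Path) :
    ∃ w : List S, w.length = p.length ∧ p.head * evalGen w = p.last := by
  have key : ∀ j (hj : j < p.length + 1), ∃ w : List S, w.length = j ∧
      p.head * evalGen w = p ⟨j, hj⟩ := by
    intro j
    induction j with
    | zero => exact fun _ => ⟨[], rfl, by simp [evalGen]; rfl⟩
    | succ j ih =>
      intro hj
      obtain ⟨w, rfl, hw⟩ := ih (by omega)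
      obtain ⟨s, hs, h⟩ := p.step ⟨w.length, by omega⟩
      refine ⟨w ++ [⟨s, hs⟩], by simp, ?_⟩
      simp only [evalGen] at hw
      simp only [evalGen, evalWord_append, evalWord_cons, evalWord_nil, mul_one, ← mul_assoc, hw]
      exact h
  exact key p.length (by omega)

theorem exists_word_of_pathDist_le {δ : ℝ≥0} {x y : M}
    (h : (rightCayleyGraph S).pathDist x y ≤ δ) :
    ∃ w : List S, w.length ≤ ⌈δ⌉₊ + 1 ∧ x * evalGen w = y := by
  have h' : (rightCayleyGraph S).pathDist x y < (⌈δ⌉₊ + 1 : ℕ) := by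
    refine h.trans_lt ?_
    rw [← ENNReal.coe_natCast, ENNReal.coe_lt_coe]
    push_cast
    exact (Nat.le_ceil δ).trans_lt (lt_add_one _)
  simp only [Digraph.pathDist, iInf_lt_iff] at h'
  obtain ⟨p, ⟨rfl, rfl⟩, hp⟩ := h'
  obtain ⟨w, hw, e⟩ := exists_word_of_path p
  refine ⟨w, ?_, e⟩
  rw [hw]
  exact_mod_cast hp.le

theorem IsGeodesicWord.isGeodesic_cayleyPath [IsLeftCancelMul M] {w : List S}
    (h : IsGeodesicWord w) (m : M) : (rightCayleyGraph S).IsGeodesic (cayleyPath m w) := by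
  refine le_antisymm (le_iInf₂ fun p hp => ?_) (iInf₂_le _ ⟨rfl, rfl⟩)
  obtain ⟨w', hw', e⟩ := exists_word_of_path p
  rw [hp.1, hp.2, cayleyPath_head, cayleyPath_last] at e
  have := h w' (mul_left_cancel e)
  rw [hw'] at this
  exact_mod_cast this

/-- Thinness of geodesic triangles, in terms of words. By left cancellation it suffices to consider
triangles that begin in the identity, and short paths are labelled by short words. -/
structure ThinWords (S : Set M) (D : ℕ) : Prop where
  third : ∀ p q r : List S, IsGeodesicWord p → IsGeodesicWord q → IsGeodesicWord r →
    evalGen p * evalGen q = evalGen r → ∀ i ≤ r.length,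
    (∃ j ≤ p.length, ∃ e : List S, e.length ≤ D ∧
      evalGen (p.take j) * evalGen e = evalGen (r.take i)) ∨
    ∃ k ≤ q.length, ∃ e : List S, e.length ≤ D ∧
      evalGen (r.take i) * evalGen e = evalGen p * evalGen (q.take k)
  first : ∀ p q r : List S, IsGeodesicWord p → IsGeodesicWord q → IsGeodesicWord r →
    evalGen p * evalGen q = evalGen r → ∀ j ≤ p.length,
    (∃ i ≤ r.length, ∃ e : List S, e.length ≤ D ∧
      evalGen (r.take i) * evalGen e = evalGen (p.take j)) ∨
    ∃ k ≤ q.length, ∃ e : List S, e.length ≤ D ∧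
      evalGen (p.take j) * evalGen e = evalGen p * evalGen (q.take k)

theorem Digraph.StronglyHyperbolic.thinWords [IsLeftCancelMul M] {δ : ℝ≥0}
    (h : (rightCayleyGraph S).StronglyHyperbolic δ) : ThinWords S (⌈δ⌉₊ + 1) := by
  have key : ∀ p q r : List S, IsGeodesicWord p → IsGeodesicWord q → IsGeodesicWord r →
      evalGen p * evalGen q = evalGen r → (rightCayleyGraph S).IsThin δ
        (cayleyPath 1 p) (cayleyPath (evalGen p) q) (cayleyPath 1 r) := fun p q r hp hq hr e =>
    h _ _ _ ⟨hp.isGeodesic_cayleyPath _, hq.isGeodesic_cayleyPath _, hr.isGeodesic_cayleyPath _,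
      by simp, by simp, by simp [e]⟩
  constructor
  · intro p q r hp hq hr e i hi
    rcases (key p q r hp hq hr e).third (mem_cayleyPath.2 ⟨i, hi, rfl⟩) with
      ⟨x, hx, hd⟩ | ⟨x, hx, hd⟩ <;>
    obtain ⟨j, hj, rfl⟩ := mem_cayleyPath.1 hx <;>
    obtain ⟨w, hw, e'⟩ := exists_word_of_pathDist_le hd
    · exact Or.inl ⟨j, hj, w, hw, by simpa using e'⟩
    · exact Or.inr ⟨j, hj, w, hw, by simpa using e'⟩
  · intro p q r hp hq hr e i hi
    rcases (key p q r hp hq hr e).first (mem_cayleyPath.2 ⟨i, hi, rfl⟩) with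
      ⟨x, hx, hd⟩ | ⟨x, hx, hd⟩ <;>
    obtain ⟨j, hj, rfl⟩ := mem_cayleyPath.1 hx <;>
    obtain ⟨w, hw, e'⟩ := exists_word_of_pathDist_le hd
    · exact Or.inl ⟨j, hj, w, hw, by simpa using e'⟩
    · exact Or.inr ⟨j, hj, w, hw, by simpa using e'⟩

end Cayley

/-! ### Filling geodesic triangles -/

section Filling

variable {M : Type*} [Monoid M] [IsLeftCancelMul M] {S : Set M} {D : ℕ}

/-- A triangle with one long side `x` can be filled with linearly many short relations: the
vertices of `x` far from its start all reach the end of the triangle by short words. -/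
theorem ThinWords.derivesWithin_of_short (h : ThinWords S D) (hgen : Submonoid.closure S = ⊤)
    {N K : ℕ} (hK : 2 * (N + D) + 1 ≤ K) {x e f : List S} (hx : IsGeodesicWord x)
    (he : e.length ≤ N) (hf : f.length ≤ N) (heq : evalGen x * evalGen e = evalGen f) :
    DerivesWithin (shortRelations (Subtype.val : S → M) K) (x.length + 1) (x ++ e) f := by
  obtain ⟨e', he', hee⟩ := exists_isGeodesicWord hgen (evalGen e)
  obtain ⟨f', hf', hff⟩ := exists_isGeodesicWord hgen (evalGen f)
  have hel := he' e hee.symm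
  have hfl := hf' f hff.symm
  -- A vertex of `x` close after a vertex of `f'` is near the start of `x` since `x` is geodesic;
  -- any other vertex reaches `e'`, hence the end of the triangle, by a short word.
  have hreach : ∀ j ≤ x.length, j ≤ N + D ∨ ∃ w : List S, w.length ≤ N + D ∧
      evalGen (x.take j) * evalGen w = evalGen f := by
    intro j hj
    rcases h.first x e' f' hx he' hf' (by rw [hee, hff, heq]) j hj with
      ⟨i, hi, w, hw, e1⟩ | ⟨k, hk, w, hw, e1⟩
    · left
      have := hx.take j (f'.take i ++ w) (by rw [evalGen_append]; exact e1)
      simp only [List.length_append, List.length_take] at this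
      omega
    · right
      refine ⟨w ++ e'.drop k, by simp; omega, ?_⟩
      rw [evalGen_append, ← mul_assoc, e1, mul_assoc, evalGen_take_mul_drop, hee, heq]
  -- Shorten `x` from its end, one cell for each letter; what is left at the start is one cell.
  have key : ∀ j ≤ x.length, ∀ w : List S, w.length ≤ N + D →
      evalGen (x.take j) * evalGen w = evalGen f →
      DerivesWithin (shortRelations (Subtype.val : S → M) K) (j + 1) (x.take j ++ w) f := by
    intro j
    induction j with
    | zero =>
      intro _ w hw e1
      exact .of_short (by simp; omega) (by omega) (by simpa using e1)
    | succ j ih =>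
      intro hj w hw e1
      have ht : x.take (j + 1) = x.take j ++ [x[j]] := List.take_succ_eq_append_getElem hj
      rcases hreach j (by omega) with hjD | ⟨w', hw', e2⟩
      · refine (DerivesWithin.of_short ?_ (by omega) ?_).mono (by omega)
        · simp; omega
        · exact (evalGen_append _ _).trans e1
      · have e3 : evalGen ([x[j]] ++ w) = evalGen w' := by
          apply mul_left_cancel (a := evalGen (x.take j))
          rw [e2, ← e1, ht, evalGen_append, evalGen_append,
            mul_assoc]
        have := (DerivesWithin.of_short (K := K) (by simp; omega) (by omega) e3).append_left
          (x.take j)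
        rw [ht, List.append_assoc]
        exact (this.trans (ih (by omega) w' hw' e2)).mono (by omega)
  simpa using key x.length le_rfl e (by omega) (by simpa using heq)

/-- Two ways of leaving a geodesic `p` that lead to the same element by short words. -/
theorem ThinWords.derivesWithin_take (h : ThinWords S D) (hgen : Submonoid.closure S = ⊤)
    {N K : ℕ} (hK : 2 * (N + D) + 1 ≤ K) {p e e' : List S} (hp : IsGeodesicWord p)
    (he : e.length ≤ N) (he' : e'.length ≤ N) {j j' : ℕ}
    (heq : evalGen (p.take j) * evalGen e = evalGen (p.take j') * evalGen e') :
    DerivesWithin (shortRelations (Subtype.val : S → M) K) (p.length + 1)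
      (p.take j ++ e) (p.take j' ++ e') := by
  wlog hjj : j ≤ j' generalizing j j' e e'
  · exact (this he' he heq.symm (by omega)).symm
  have ht : p.take j' = p.take j ++ (p.drop j).take (j' - j) := by
    rw [← List.take_add, show j + (j' - j) = j' by omega]
  have := h.derivesWithin_of_short hgen hK ((hp.drop j).take (j' - j)) he' he (by
    apply mul_left_cancel (a := evalGen (p.take j))
    rw [heq, ht, evalGen_append, mul_assoc])
  rw [ht, List.append_assoc]
  exact (this.append_left _).symm.mono (by simp)

/-- A geodesic triangle whose second side has length at most one can be filled with quadratically
many short relations: it is swept out by short words that lead from `p` to the vertices of `r`. -/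
theorem ThinWords.derivesWithin_triangle (h : ThinWords S D) (hgen : Submonoid.closure S = ⊤)
    {K : ℕ} (hK : 6 * D + 5 ≤ K) {p q r : List S} (hp : IsGeodesicWord p) (hq : IsGeodesicWord q)
    (hr : IsGeodesicWord r) (hql : q.length ≤ 1) (heq : evalGen p * evalGen q = evalGen r) :
    DerivesWithin (shortRelations (Subtype.val : S → M) K) ((r.length + 2) * (p.length + 1))
      (p ++ q) r := by
  -- The longest short word that occurs is `e ++ r.drop i` below, of length at most `D + (D + 2)`.
  have hK' : 2 * ((2 * D + 2) + D) + 1 ≤ K := by omega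
  -- A vertex of `r` from which `q` can be reached is close to the end of `r`.
  have hfrom : ∀ i, i + D + 1 < r.length → ∃ j ≤ p.length, ∃ e : List S, e.length ≤ D ∧
      evalGen (p.take j) * evalGen e = evalGen (r.take i) := by
    intro i hi
    rcases h.third p q r hp hq hr heq i (by omega) with h1 | ⟨k, hk, e, he, e1⟩
    · exact h1
    · exfalso
      have := hr.drop i (e ++ q.drop k) (by
        apply mul_left_cancel (a := evalGen (r.take i))
        rw [evalGen_append, ← mul_assoc, e1, evalGen_take_mul_drop, mul_assoc,
          evalGen_take_mul_drop, heq])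
      simp only [List.length_append, List.length_drop] at this
      omega
  -- Sweep along `r`. The vertex `j` from which `r.take i` is reached is arbitrary, so the short
  -- words at consecutive vertices need not be related.
  have key : ∀ i, (i = 0 ∨ i + D + 1 < r.length) → ∀ j, ∀ e : List S, e.length ≤ D →
      evalGen (p.take j) * evalGen e = evalGen (r.take i) →
      DerivesWithin (shortRelations (Subtype.val : S → M) K) ((i + 1) * (p.length + 1))
        (p.take j ++ e) (r.take i) := by
    intro i
    induction i with
    | zero =>
      intro _ j e he e1
      simpa using h.derivesWithin_take hgen (N := 2 * D + 2) hK' hp (e := e) (e' := []) (j := j)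
        (j' := 0) (by omega) (by simp) (by simpa using e1)
    | succ i ih =>
      intro hi j e he e1
      obtain ⟨j', -, e', he', e2⟩ := hfrom i (by omega)
      have ht : r.take (i + 1) = r.take i ++ [r[i]'(by omega)] :=
        List.take_succ_eq_append_getElem (by omega)
      have h1 := h.derivesWithin_take hgen (N := 2 * D + 2) hK' hp (e := e)
        (e' := e' ++ [r[i]'(by omega)]) (j := j) (j' := j') (by omega) (by simp; omega) (by
          rw [e1, ht, evalGen_append, evalGen_append, ← mul_assoc, e2])
      have h2 := (ih (by omega) j' e' he' e2).append_right [r[i]'(by omega)]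
      rw [List.append_assoc, ← ht] at h2
      exact (h1.trans h2).mono (by lia)
  obtain ⟨i, hi, hi'⟩ : ∃ i, (i = 0 ∨ i + D + 1 < r.length) ∧ r.length ≤ i + D + 2 :=
    ⟨r.length - (D + 2), by omega, by omega⟩
  obtain ⟨j, e, he, e1⟩ : ∃ j, ∃ e : List S, e.length ≤ D ∧
      evalGen (p.take j) * evalGen e = evalGen (r.take i) := by
    rcases hi with rfl | hi
    · exact ⟨0, [], by simp, by simp⟩
    · obtain ⟨j, -, e, h⟩ := hfrom i hi
      exact ⟨j, e, h⟩
  have h1 := h.derivesWithin_take hgen (N := 2 * D + 2) hK' hp (e := q) (e' := e ++ r.drop i)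
    (j := p.length) (j' := j) (by omega) (by simp; omega) (by
      rw [List.take_length, heq, evalGen_append, ← mul_assoc, e1, evalGen_take_mul_drop])
  have h2 := (key i hi j e he e1).append_right (r.drop i)
  rw [List.append_assoc, List.take_append_drop] at h2
  rw [List.take_length] at h1
  have hir : i ≤ r.length := by omega
  refine (h1.trans h2).mono ?_
  calc p.length + 1 + (i + 1) * (p.length + 1) = (i + 2) * (p.length + 1) := by ring
    _ ≤ _ := by gcongr

/-- Every word can be transformed into a given geodesic word that represents the same element, by
adding one letter at a time and filling the resulting geodesic triangles. -/
theorem ThinWords.derivesWithin_geodesic (h : ThinWords S D) (hgen : Submonoid.closure S = ⊤)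
    {K : ℕ} (hK : 6 * D + 5 ≤ K) (u : List S) : ∀ w : List S, IsGeodesicWord w →
    evalGen w = evalGen u →
    DerivesWithin (shortRelations (Subtype.val : S → M) K) (u.length * (u.length + 2) ^ 2 + 1)
      u w := by
  induction u using List.reverseRecOn with
  | nil =>
    intro w hw e
    have : w.length ≤ 0 := hw [] e.symm
    exact .of_short (by simp) (by omega) e.symm
  | append_singleton u a ih =>
    intro w hw e
    obtain ⟨p, hp, hpu⟩ := exists_isGeodesicWord hgen (evalGen u)
    obtain ⟨q, hq, hqa⟩ := exists_isGeodesicWord hgen (evalGen [a])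
    have hpl := hp u hpu.symm
    have hql := hq [a] hqa.symm
    have hwl := hw (u ++ [a]) e.symm
    simp only [List.length_append, List.length_singleton] at hql hwl ⊢
    have h1 := (ih p hp hpu).append_right [a]
    have h2 := (DerivesWithin.of_short (g := (Subtype.val : S → M)) (K := K) (by simp; omega)
      (by omega) hqa.symm).append_left p
    have h3 := h.derivesWithin_triangle hgen hK hp hq hw hql (by
      rw [hpu, hqa, e, evalGen_append])
    refine ((h1.trans h2).trans h3).mono ?_
    have h4 : (w.length + 2) * (p.length + 1) ≤ (u.length + 1 + 2) * (u.length + 1) := by gcongr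
    nlinarith

/-- Two words that represent the same element are both transformed into the same geodesic word. -/
theorem ThinWords.derivesWithin (h : ThinWords S D) (hgen : Submonoid.closure S = ⊤)
    {K : ℕ} (hK : 6 * D + 5 ≤ K) {L : ℕ} {u v : List S} (hu : u.length ≤ L) (hv : v.length ≤ L)
    (heq : evalGen u = evalGen v) :
    DerivesWithin (shortRelations (Subtype.val : S → M) K) (2 * (L * (L + 2) ^ 2 + 1)) u v := by
  obtain ⟨w, hw, e⟩ := exists_isGeodesicWord hgen (evalGen u)
  refine ((h.derivesWithin_geodesic hgen hK u w hw e).trans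
    (h.derivesWithin_geodesic hgen hK v w hw (e.trans heq)).symm).mono ?_
  have h1 : u.length * (u.length + 2) ^ 2 ≤ L * (L + 2) ^ 2 := by gcongr
  have h2 : v.length * (v.length + 2) ^ 2 ≤ L * (L + 2) ^ 2 := by gcongr
  omega

/-- Change of generators: words over any finite set of generators are rewritten as words over the
generating set for which triangles are thin, and back. -/
theorem ThinWords.exists_presentation (h : ThinWords S D) (hfin : S.Finite)
    (hgen : Submonoid.closure S = ⊤) {α : Type*} [Finite α] (g : α → M)
    (hg : Submonoid.closure (Set.range g) = ⊤) :
    ∃ (K : ℕ) (P : Polynomial ℕ), IsMonoidPresentation g (shortRelations g K) ∧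
      DehnFunctionLE (shortRelations g K) (fun m => P.eval m) := by
  have := hfin.to_subtype
  choose σ hσ using fun s : S => exists_evalWord_eq g hg s
  choose τ hτ using fun a : α => exists_evalWord_eq (Subtype.val : S → M) (by simpa using hgen)
    (g a)
  obtain ⟨C, hC⟩ : ∃ C, ∀ s, (σ s).length ≤ C :=
    (Set.finite_range fun s => (σ s).length).bddAbove.imp fun C hC s => hC ⟨s, rfl⟩
  obtain ⟨C', hC'⟩ : ∃ C, ∀ a, (τ a).length ≤ C :=
    (Set.finite_range fun a => (τ a).length).bddAbove.imp fun C hC a => hC ⟨a, rfl⟩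
  set K := 6 * D + 5 with hK
  -- Each letter `a` is replaced by the word `(τ a).flatMap σ`, at the cost of one relation.
  have hback : ∀ u : List α, DerivesWithin (shortRelations g (C * K + C * C' + 1)) u.length
      u ((u.flatMap τ).flatMap σ) := by
    intro u
    induction u with
    | nil => exact .refl _ _
    | cons a u ih =>
      have h1 : DerivesWithin (shortRelations g (C * K + C * C' + 1)) 1 [a] ((τ a).flatMap σ) := by
        refine .of_short (by simp) ?_ ?_
        · have := (length_flatMap_le hC (τ a)).trans (Nat.mul_le_mul_left C (hC' a))
          omega
        · rw [evalWord_flatMap _ hσ, hτ]; simp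
      have := (h1.append_right u).trans (ih.append_left ((τ a).flatMap σ))
      simpa [add_comm] using this
  set P : Polynomial ℕ := 2 * Polynomial.X +
    2 * (Polynomial.C C' * Polynomial.X * (Polynomial.C C' * Polynomial.X + 2) ^ 2 + 1) with hP
  have key : ∀ (m : ℕ) (u v : List α), evalWord g u = evalWord g v → u.length + v.length ≤ m →
      DerivesWithin (shortRelations g (C * K + C * C' + 1)) (P.eval m) u v := by
    intro m u v e hm
    have hl : ∀ u : List α, u.length ≤ m → (u.flatMap τ).length ≤ C' * m := fun u hu =>
      (length_flatMap_le hC' u).trans (Nat.mul_le_mul_left C' hu)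
    have h1 := (h.derivesWithin hgen hK.ge (hl u (by omega)) (hl v (by omega)) (by
      rw [evalGen, evalGen, evalWord_flatMap _ hτ, evalWord_flatMap _ hτ, e])).flatMap hσ hC
      (K' := C * K + C * C' + 1) (by omega)
    refine (((hback u).trans h1).trans (hback v).symm).mono ?_
    simp [hP]
    omega
  have hsound : ∀ x ∈ shortRelations g (C * K + C * C' + 1), evalWord g x.1 = evalWord g x.2 :=
    fun x hx => hx.2.2
  refine ⟨C * K + C * C' + 1, P,
    ⟨hg, fun u v => ⟨fun e => ?_, fun ⟨k, hk⟩ => hk.evalWord_eq hsound⟩⟩,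
    fun m u v ⟨k, hk⟩ hm => key m u v (hk.evalWord_eq hsound) hm⟩
  obtain ⟨k, -, hk⟩ := key _ u v e le_rfl
  exact ⟨k, hk⟩

end Filling

/-! ### Stack automata run in polynomial time -/

/-- What an automaton does to one of its stacks in one step. -/
inductive StackAction (A : Type)
  | keep
  | pop
  | push (a : A)

namespace StackAction

variable {A : Type}

/-- The effect of an action on the contents of a stack, whose top is the head of the list. -/
def apply : StackAction A → List A → List A
  | keep, l => l
  | pop, l => l.tail
  | push a, l => a :: l

/-- Whether the action removes the top symbol. -/
def isPop : StackAction A → Bool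
  | pop => true
  | _ => false

/-- The symbol written by the action, if any. -/
def pushed : StackAction A → Option A
  | push a => some a
  | _ => none

theorem length_apply_le (x : StackAction A) (l : List A) : (x.apply l).length ≤ l.length + 1 := by
  cases x <;> simp [apply]; omega

end StackAction

/-- The stacks of the Turing machine that simulates an automaton. -/
inductive StackAutomaton.Tape
  | input
  | left
  | right
  | target
  | output
  deriving DecidableEq

instance : Fintype StackAutomaton.Tape :=
  ⟨{.input, .left, .right, .target, .output}, fun k => by cases k <;> simp⟩

/-- A deterministic automaton with three stacks over `A`. It reads one input symbol in each step
and decides, from its state and the tops of the stacks, on the next state and on an action for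
each of the stacks. -/
structure StackAutomaton (I A Q : Type) where
  /-- the state in which a run begins, with empty stacks -/
  start : Q
  /-- the transition function -/
  next : Q → I → Option A → Option A → Option A →
    Q × StackAction A × StackAction A × StackAction A
  /-- the states in which a word may be accepted -/
  final : Q → Bool

namespace StackAutomaton

variable {I A Q : Type} (T : StackAutomaton I A Q)

/-- A state of the automaton together with the contents of the stacks. -/
structure Config (A Q : Type) where
  /-- the state -/
  state : Q
  /-- the first stack -/
  left : List A
  /-- the second stack -/
  right : List A
  /-- the third stack -/
  target : List A

/-- One step of the automaton. -/
def step (c : Config A Q) (i : I) : Config A Q :=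
  let x := T.next c.state i c.left.head? c.right.head? c.target.head?
  ⟨x.1, x.2.1.apply c.left, x.2.2.1.apply c.right, x.2.2.2.apply c.target⟩

/-- Acceptance by a final state and empty stacks. -/
def accepts (c : Config A Q) : Bool :=
  T.final c.state && c.left.isEmpty && c.right.isEmpty && c.target.isEmpty

/-- The configuration reached from `c` by reading `w`. -/
def run (c : Config A Q) (w : List I) : Config A Q := w.foldl T.step c

/-- The configuration in which a run begins. -/
def init : Config A Q := ⟨T.start, [], [], []⟩

/-- The alphabets of the stacks of the simulating machine. Stack symbols of the automaton are
wrapped in `Option` since a machine that pushes conditionally needs a default symbol. -/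
def Tape.alphabet (I A : Type) : Tape → Type
  | .input => I
  | .output => Bool
  | _ => Option A

/-- The internal state of the simulating machine: the state of the automaton, a flag which is
`false` once stacks have been discarded at the end of the input, and registers for the input symbol
and the tops of the stacks. -/
structure Memory (I A Q : Type) where
  /-- the state of the automaton -/
  state : Q
  /-- `false` once stack symbols have been discarded -/
  ok : Bool
  /-- the input symbol that was read -/
  input : Option I
  /-- the top of the first stack -/
  left : Option A
  /-- the top of the second stack -/
  right : Option A
  /-- the top of the third stack -/
  target : Option A

/-- `Memory` as a product. -/
def Memory.equivProd :
    Memory I A Q ≃ Q × Bool × Option I × Option A × Option A × Option A where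
  toFun s := (s.state, s.ok, s.input, s.left, s.right, s.target)
  invFun x := ⟨x.1, x.2.1, x.2.2.1, x.2.2.2.1, x.2.2.2.2.1, x.2.2.2.2.2⟩
  left_inv _ := rfl
  right_inv _ := rfl

instance [Finite I] [Finite A] [Finite Q] : Finite (Memory I A Q) :=
  Finite.of_equiv _ Memory.equivProd.symm

/-- Memory with cleared registers. -/
def Memory.clear (q : Q) (ok : Bool) : Memory I A Q := ⟨q, ok, none, none, none, none⟩

/-- The state and the actions chosen for the contents of the registers. At the end of the input
all stacks are emptied. -/
def Memory.next (s : Memory I A Q) :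
    Q × StackAction A × StackAction A × StackAction A :=
  match s.input with
  | some i => T.next s.state i s.left s.right s.target
  | none => (s.state, .pop, .pop, .pop)

/-- The simulation is complete when all stacks are empty. -/
def Memory.done (s : Memory I A Q) : Bool :=
  s.input.isNone && s.left.isNone && s.right.isNone && s.target.isNone

/-- Stack programs of the simulating machine. -/
abbrev Program (I A Q : Type) : Type :=
  Turing.TM2.Stmt (Tape.alphabet I A) Unit (Memory I A Q)

/-- The program that performs an action on the first stack. -/
def Program.actLeft (f : Memory I A Q → StackAction A) (p : Program I A Q) : Program I A Q :=
  .branch (fun s => (f s).isPop) (.pop .left (fun s _ => s) p)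
    (.branch (fun s => (f s).pushed.isSome) (.push .left (fun s => (f s).pushed) p) p)

/-- The program that performs an action on the second stack. -/
def Program.actRight (f : Memory I A Q → StackAction A) (p : Program I A Q) : Program I A Q :=
  .branch (fun s => (f s).isPop) (.pop .right (fun s _ => s) p)
    (.branch (fun s => (f s).pushed.isSome) (.push .right (fun s => (f s).pushed) p) p)

/-- The program that performs an action on the third stack. -/
def Program.actTarget (f : Memory I A Q → StackAction A) (p : Program I A Q) : Program I A Q :=
  .branch (fun s => (f s).isPop) (.pop .target (fun s _ => s) p)
    (.branch (fun s => (f s).pushed.isSome) (.push .target (fun s => (f s).pushed) p) p)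

/-- The program of the simulating machine, one round of which simulates one step of the
automaton. -/
def program : Program I A Q :=
  .pop .input (fun s (x : Option I) => { s with input := x }) <|
  .peek .left (fun s (x : Option (Option A)) => { s with left := x.join }) <|
  .peek .right (fun s (x : Option (Option A)) => { s with right := x.join }) <|
  .peek .target (fun s (x : Option (Option A)) => { s with target := x.join }) <|
  .branch Memory.done
    (.push .output (fun s => (s.ok && T.final s.state : Bool)) <|
      .load (fun _ => .clear T.start true) .halt)
    (Program.actLeft (fun s => (s.next T).2.1) <|
      Program.actRight (fun s => (s.next T).2.2.1) <|
      Program.actTarget (fun s => (s.next T).2.2.2) <|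
      .load (fun s => .clear (s.next T).1 (s.ok && s.input.isSome)) <|
      .goto (fun _ => ()))

/-- The contents of the stacks of the simulating machine. -/
def tapes (w : List I) (l r t : List A) (o : List Bool) : ∀ k, List (Tape.alphabet I A k)
  | .input => w
  | .left => (l.map some : List (Option A))
  | .right => (r.map some : List (Option A))
  | .target => (t.map some : List (Option A))
  | .output => o

section

variable (w : List I) (l r t : List A) (o : List Bool)

theorem update_input (w' : List I) :
    Function.update (tapes w l r t o) Tape.input w' = tapes w' l r t o := by
  funext k; cases k <;> rfl

theorem update_left (l' : List A) :
    Function.update (tapes w l r t o) Tape.left (l'.map some : List (Option A)) =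
      tapes w l' r t o := by
  funext k; cases k <;> rfl

theorem update_right (r' : List A) :
    Function.update (tapes w l r t o) Tape.right (r'.map some : List (Option A)) =
      tapes w l r' t o := by
  funext k; cases k <;> rfl

theorem update_target (t' : List A) :
    Function.update (tapes w l r t o) Tape.target (t'.map some : List (Option A)) =
      tapes w l r t' o := by
  funext k; cases k <;> rfl

theorem update_output (o' : List Bool) :
    Function.update (tapes w l r t o) Tape.output o' = tapes w l r t o' := by
  funext k; cases k <;> rfl

theorem stepAux_actLeft (f : Memory I A Q → StackAction A) (p : Program I A Q)
    (s : Memory I A Q) :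
    Turing.TM2.stepAux (Program.actLeft f p) s (tapes w l r t o) =
      Turing.TM2.stepAux p s (tapes w ((f s).apply l) r t o) := by
  cases h : f s with
  | keep => simp [Program.actLeft, h, StackAction.isPop, StackAction.pushed, StackAction.apply]
  | pop =>
    simp only [Program.actLeft, Turing.TM2.stepAux, h, StackAction.isPop, cond_true,
      StackAction.apply]
    rw [← update_left w l r t o l.tail, List.map_tail]; rfl
  | push a =>
    simp only [Program.actLeft, Turing.TM2.stepAux, h, StackAction.isPop, StackAction.pushed,
      cond_true, cond_false, StackAction.apply, Option.isSome_some]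
    rw [← update_left w l r t o (a :: l)]; rfl

theorem stepAux_actRight (f : Memory I A Q → StackAction A) (p : Program I A Q)
    (s : Memory I A Q) :
    Turing.TM2.stepAux (Program.actRight f p) s (tapes w l r t o) =
      Turing.TM2.stepAux p s (tapes w l ((f s).apply r) t o) := by
  cases h : f s with
  | keep => simp [Program.actRight, h, StackAction.isPop, StackAction.pushed, StackAction.apply]
  | pop =>
    simp only [Program.actRight, Turing.TM2.stepAux, h, StackAction.isPop, cond_true,
      StackAction.apply]
    rw [← update_right w l r t o r.tail, List.map_tail]; rfl
  | push a =>
    simp only [Program.actRight, Turing.TM2.stepAux, h, StackAction.isPop, StackAction.pushed,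
      cond_true, cond_false, StackAction.apply, Option.isSome_some]
    rw [← update_right w l r t o (a :: r)]; rfl

theorem stepAux_actTarget (f : Memory I A Q → StackAction A) (p : Program I A Q)
    (s : Memory I A Q) :
    Turing.TM2.stepAux (Program.actTarget f p) s (tapes w l r t o) =
      Turing.TM2.stepAux p s (tapes w l r ((f s).apply t) o) := by
  cases h : f s with
  | keep => simp [Program.actTarget, h, StackAction.isPop, StackAction.pushed, StackAction.apply]
  | pop =>
    simp only [Program.actTarget, Turing.TM2.stepAux, h, StackAction.isPop, cond_true,
      StackAction.apply]
    rw [← update_target w l r t o t.tail, List.map_tail]; rfl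
  | push a =>
    simp only [Program.actTarget, Turing.TM2.stepAux, h, StackAction.isPop, StackAction.pushed,
      cond_true, cond_false, StackAction.apply, Option.isSome_some]
    rw [← update_target w l r t o (a :: t)]; rfl

end

theorem join_head?_map_some (l : List A) : (l.map some).head?.join = l.head? := by
  cases l <;> rfl

/-- One round of the program. -/
theorem stepAux_program (q : Q) (ok : Bool) (w : List I) (l r t : List A) :
    Turing.TM2.stepAux T.program (.clear q ok) (tapes w l r t []) =
      let s : Memory I A Q := ⟨q, ok, w.head?, l.head?, r.head?, t.head?⟩
      cond s.done ⟨none, .clear T.start true, tapes w.tail l r t [ok && T.final q]⟩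
        ⟨some (), .clear (s.next T).1 (ok && w.head?.isSome),
          tapes w.tail ((s.next T).2.1.apply l) ((s.next T).2.2.1.apply r)
            ((s.next T).2.2.2.apply t) []⟩ := by
  unfold program
  simp only [Turing.TM2.stepAux]
  have h1 : Function.update (tapes w l r t []) Tape.input (tapes w l r t [] Tape.input).tail =
      tapes w.tail l r t [] := update_input ..
  rw [h1]
  have h2 : (tapes w l r t [] Tape.input).head? = w.head? := rfl
  have h3 : ((tapes w.tail l r t [] Tape.left).head? : Option (Option A)).join = l.head? :=
    join_head?_map_some l
  have h4 : ((tapes w.tail l r t [] Tape.right).head? : Option (Option A)).join = r.head? :=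
    join_head?_map_some r
  have h5 : ((tapes w.tail l r t [] Tape.target).head? : Option (Option A)).join = t.head? :=
    join_head?_map_some t
  rw [h2, h3, h4, h5]
  congr 1
  · congr 1
    exact update_output ..
  · rw [stepAux_actLeft, stepAux_actRight, stepAux_actTarget]
    rfl

/-- The Turing machine simulating an automaton. It has a single label, so that a round of its
program is one step, and all its stack alphabets are finite. -/
noncomputable def machine [Finite I] [Finite A] [Finite Q] : Turing.FinTM2 where
  K := Tape
  k₀ := .input
  k₁ := .output
  Γ := Tape.alphabet I A
  Λ := Unit
  main := ()
  σ := Memory I A Q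
  initialState := .clear T.start true
  σFin := Fintype.ofFinite _
  Γk₀Fin := Fintype.ofFinite I
  m _ := T.program

section

variable [Finite I] [Finite A] [Finite Q]

/-- The configurations of the simulating machine between rounds. -/
def cfg (ok : Bool) (w : List I) (c : Config A Q) : T.machine.Cfg :=
  ⟨some (), .clear c.state ok, tapes w c.left c.right c.target []⟩

/-- The iterated step function of the simulating machine. -/
noncomputable abbrev iterStep (n : ℕ) (c : Option T.machine.Cfg) : Option T.machine.Cfg :=
  (flip bind T.machine.step)^[n] c

theorem iterStep_succ (n : ℕ) (c : T.machine.Cfg) :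
    T.iterStep (n + 1) (some c) = T.iterStep n (T.machine.step c) := rfl

theorem step_cfg_cons (i : I) (w : List I) (c : Config A Q) :
    T.machine.step (T.cfg true (i :: w) c) = some (T.cfg true w (T.step c i)) :=
  congrArg some (T.stepAux_program c.state true (i :: w) c.left c.right c.target)

theorem step_cfg_nil (ok : Bool) (c : Config A Q)
    (h : c.left ≠ [] ∨ c.right ≠ [] ∨ c.target ≠ []) :
    T.machine.step (T.cfg ok [] c) =
      some (T.cfg false [] ⟨c.state, c.left.tail, c.right.tail, c.target.tail⟩) := by
  refine (congrArg some (T.stepAux_program c.state ok [] c.left c.right c.target)).trans ?_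
  have : Memory.done (⟨c.state, ok, none, c.left.head?, c.right.head?, c.target.head?⟩ :
      Memory I A Q) = false := by
    simp only [Memory.done, Bool.and_eq_false_iff]
    simp
    tauto
  simp only [List.head?_nil, this, cond_false, Option.isSome_none, Bool.and_false]
  rfl

theorem initList_eq (w : List I) : Turing.initList T.machine w = T.cfg true w T.init := by
  unfold Turing.initList cfg
  congr 1
  funext k
  cases k <;> rfl

theorem step_cfg_empty (ok : Bool) (q : Q) :
    T.machine.step (T.cfg ok [] ⟨q, [], [], []⟩) =
      some (Turing.haltList T.machine [ok && T.final q]) := by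
  refine (congrArg some (T.stepAux_program q ok [] [] [] [])).trans ?_
  congr 1
  unfold Turing.haltList
  simp only [List.head?_nil, Memory.done, Option.isNone_none, Bool.and_self, cond_true]
  congr 1
  funext k
  cases k <;> rfl

/-- After the input has been read, the machine empties its stacks and stops. -/
theorem exists_iterStep_nil (N : ℕ) (ok : Bool) (c : Config A Q) (h1 : c.left.length ≤ N)
    (h2 : c.right.length ≤ N) (h3 : c.target.length ≤ N) :
    ∃ n ≤ N + 1, T.iterStep n (some (T.cfg ok [] c)) =
      some (Turing.haltList T.machine [ok && T.accepts c]) := by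
  induction N generalizing ok c with
  | zero =>
    obtain ⟨q, l, r, t⟩ := c
    simp only [Nat.le_zero, List.length_eq_zero_iff] at h1 h2 h3
    subst h1 h2 h3
    refine ⟨1, le_rfl, ?_⟩
    rw [iterStep_succ, step_cfg_empty]
    simp [accepts, iterStep]
  | succ N ih =>
    by_cases h : c.left ≠ [] ∨ c.right ≠ [] ∨ c.target ≠ []
    · obtain ⟨n, hn, e⟩ := ih false ⟨c.state, c.left.tail, c.right.tail, c.target.tail⟩
        (by simp; omega) (by simp; omega) (by simp; omega)
      refine ⟨n + 1, by omega, ?_⟩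
      rw [iterStep_succ, step_cfg_nil T ok c h, e]
      have : T.accepts c = false := by
        simp only [accepts, Bool.and_eq_false_iff, List.isEmpty_eq_false_iff]
        tauto
      simp [this]
    · obtain ⟨q, l, r, t⟩ := c
      simp only [ne_eq, not_or, not_not] at h
      obtain ⟨rfl, rfl, rfl⟩ := h
      obtain ⟨n, hn, e⟩ := ih ok ⟨q, [], [], []⟩ (by simp) (by simp) (by simp)
      exact ⟨n, by omega, e⟩

/-- Each stack grows by at most one symbol for each input symbol, so emptying the stacks takes no
longer than reading the input. -/
theorem exists_iterStep (w : List I) (N : ℕ) (c : Config A Q) (h1 : c.left.length ≤ N)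
    (h2 : c.right.length ≤ N) (h3 : c.target.length ≤ N) :
    ∃ n ≤ 2 * w.length + N + 1, T.iterStep n (some (T.cfg true w c)) =
      some (Turing.haltList T.machine [T.accepts (T.run c w)]) := by
  induction w generalizing N c with
  | nil => simpa [run] using T.exists_iterStep_nil N true c h1 h2 h3
  | cons i w ih =>
    obtain ⟨n, hn, e⟩ := ih (N + 1) (T.step c i)
      ((StackAction.length_apply_le _ _).trans (by omega))
      ((StackAction.length_apply_le _ _).trans (by omega))
      ((StackAction.length_apply_le _ _).trans (by omega))
    refine ⟨n + 1, by simp; omega, ?_⟩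
    rw [iterStep_succ, step_cfg_cons, e]
    rfl

/-- Acceptance by a stack automaton is decided by a Turing machine in at most `2 n + 1` steps for
inputs of length `n`. -/
theorem computableInPolyTime {β : Type} (enc : β → List I) :
    Nonempty (Turing.TM2ComputableInPolyTime enc Computability.encodingBoolBool.encode
      (fun x => T.accepts (T.run T.init (enc x)))) := by
  refine ⟨{
    tm := T.machine
    inputAlphabet := Equiv.refl I
    outputAlphabet := Equiv.refl Bool
    time := 2 * Polynomial.X + 1
    outputsFun := fun x => ?_ }⟩
  have h := T.exists_iterStep (enc x) 0 T.init (by simp [init]) (by simp [init]) (by simp [init])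
  refine ⟨⟨h.choose, ?_⟩, ?_⟩
  · have e : List.map (Equiv.refl I).invFun (enc x) = enc x := List.map_id _
    refine Eq.trans ?_ h.choose_spec.2
    unfold iterStep
    congr 2
    exact (congrArg (Turing.initList T.machine) e).trans (T.initList_eq _)
  · simpa using h.choose_spec.1

end

end StackAutomaton

/-! ### A verifier for the word problem -/

/-- The instructions of which a certificate consists. They act on a word `L ++ b ++ R`, where the
first stack holds `L` with its last letter on top, the bounded buffer `b` is part of the state, and
the second stack holds `R` with its first letter on top. The third stack holds the word to be
compared with, with its last letter on top. -/
inductive Instr (B : Type)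
  /-- move the last letter of `L` to `R` (if `b` is empty) -/
  | toRight
  /-- move the first letter of `R` to `L` (if `b` is empty) -/
  | toLeft
  /-- move the last letter of `L` to `b` -/
  | absorb
  /-- move the first letter of `b` to `L` -/
  | emit
  /-- replace `b` by a word that represents the same element -/
  | replace (b : B)
  /-- remove equal last letters of `L` and of the third word (if `b` and `R` are empty) -/
  | cancel

instance {B : Type} [Finite B] : Finite (Instr B) := by
  refine Finite.of_surjective (fun x : Fin 5 ⊕ B => match x with
    | .inl 0 => Instr.toRight
    | .inl 1 => .toLeft
    | .inl 2 => .absorb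
    | .inl 3 => .emit
    | .inl 4 => .cancel
    | .inr b => .replace b) fun x => ?_
  cases x with
  | toRight => exact ⟨.inl 0, rfl⟩
  | toLeft => exact ⟨.inl 1, rfl⟩
  | absorb => exact ⟨.inl 2, rfl⟩
  | emit => exact ⟨.inl 3, rfl⟩
  | cancel => exact ⟨.inl 4, rfl⟩
  | replace b => exact ⟨.inr b, rfl⟩

/-- The possible contents of the buffer: the words of length at most `K`. -/
abbrev Buffer (A : Type) (K : ℕ) : Type := {b : List A // b.length ≤ K}

/-- The states of the verifier: `none` after a failure, `some (false, _)` while the first word is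
read, and `some (true, b)` with buffer `b` after the separator. -/
abbrev VerifierState (A : Type) (K : ℕ) : Type := Option (Bool × Buffer A K)

namespace Verifier

open StackAction

variable {M : Type*} {A : Type} [Monoid M] (g : A → M) (K : ℕ)

/-- The state with buffer `b`, or failure if `b` does not fit. -/
def withBuffer (b : List A) : VerifierState A K :=
  if h : b.length ≤ K then some (true, ⟨b, h⟩) else none

open Classical in
/-- The effect of an instruction for the given buffer and tops of the stacks. -/
noncomputable def exec (b : Buffer A K) : Instr (Buffer A K) → Option A → Option A → Option A →
    VerifierState A K × StackAction A × StackAction A × StackAction A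
  | .toRight, some a, _, _ =>
    if b.1 = [] then (some (true, b), pop, push a, keep) else (none, keep, keep, keep)
  | .toLeft, _, some a, _ =>
    if b.1 = [] then (some (true, b), push a, pop, keep) else (none, keep, keep, keep)
  | .absorb, some a, _, _ => (withBuffer K (a :: b.1), pop, keep, keep)
  | .emit, _, _, _ =>
    match b.1 with
    | a :: b' => (withBuffer K b', push a, keep, keep)
    | [] => (none, keep, keep, keep)
  | .replace b', _, _, _ =>
    if evalWord g b.1 = evalWord g b'.1 then (some (true, b'), keep, keep, keep)
    else (none, keep, keep, keep)
  | .cancel, some a, none, some a' =>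
    if b.1 = [] ∧ a = a' then (some (true, b), pop, keep, pop) else (none, keep, keep, keep)
  | _, _, _, _ => (none, keep, keep, keep)

/-- The verifier as a stack automaton. It reads `u # v` followed by a certificate. -/
noncomputable def automaton :
    StackAutomaton (Option A ⊕ Instr (Buffer A K)) A (VerifierState A K) where
  start := some (false, ⟨[], K.zero_le⟩)
  next
    | some (false, b), .inl (some a), _, _, _ => (some (false, b), push a, keep, keep)
    | some (false, b), .inl none, _, _, _ => (some (true, b), keep, keep, keep)
    | some (true, b), .inl (some a), _, _, _ => (some (true, b), keep, keep, push a)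
    | some (true, b), .inr x, l, r, t => exec g K b x l r t
    | _, _, _, _, _ => (none, keep, keep, keep)
  final
    | some (true, b) => b.1.isEmpty
    | _ => false

/-- The configuration with the words `L.reverse`, `b`, `R` and `T.reverse`. -/
abbrev conf (b : Buffer A K) (L R T : List A) : StackAutomaton.Config A (VerifierState A K) :=
  ⟨some (true, b), L, R, T⟩

/-- The empty buffer. -/
def noBuffer : Buffer A K := ⟨[], K.zero_le⟩

/-! ### Soundness of the verifier -/

theorem not_accepts_of_none {c : StackAutomaton.Config A (VerifierState A K)}
    (h : c.state = none) (w : List (Option A ⊕ Instr (Buffer A K))) :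
    (automaton g K).accepts ((automaton g K).run c w) = false := by
  induction w generalizing c with
  | nil => simp [StackAutomaton.run, StackAutomaton.accepts, h, automaton]
  | cons x w ih =>
    exact ih (c := (automaton g K).step c x) (by simp [StackAutomaton.step, h, automaton])

/-- An instruction that does not fail never makes two words equal that were not. -/
theorem step_sound (b : Buffer A K) (L R T : List A) (x : Instr (Buffer A K)) :
    ((automaton g K).step (conf K b L R T) (.inr x)).state = none ∨ ∃ b' L' R' T',
      (automaton g K).step (conf K b L R T) (.inr x) = conf K b' L' R' T' ∧
      (evalWord g (L'.reverse ++ b'.1 ++ R') = evalWord g T'.reverse →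
        evalWord g (L.reverse ++ b.1 ++ R) = evalWord g T.reverse) := by
  obtain ⟨b, hb⟩ := b
  simp only [StackAutomaton.step, automaton, conf]
  cases x with
  | toRight =>
    cases L with
    | nil => simp [exec]
    | cons a L =>
      simp only [exec, List.head?_cons]
      split_ifs with h
      · refine .inr ⟨_, _, _, _, rfl, fun e => ?_⟩
        obtain rfl : b = [] := h
        simpa [apply] using e
      · exact .inl rfl
  | toLeft =>
    cases R with
    | nil => simp [exec]
    | cons a R =>
      simp only [exec, List.head?_cons]
      split_ifs with h
      · refine .inr ⟨_, _, _, _, rfl, fun e => ?_⟩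
        obtain rfl : b = [] := h
        simpa [apply] using e
      · exact .inl rfl
  | absorb =>
    cases L with
    | nil => simp [exec]
    | cons a L =>
      simp only [exec, List.head?_cons, withBuffer]
      split_ifs with h
      · exact .inr ⟨_, _, _, _, rfl, fun e => by simpa [apply] using e⟩
      · exact .inl rfl
  | emit =>
    cases b with
    | nil => simp [exec]
    | cons a b =>
      simp only [exec, withBuffer]
      split_ifs with h
      · exact .inr ⟨_, _, _, _, rfl, fun e => by simpa [apply] using e⟩
      · exact .inl rfl
  | replace b' =>
    simp only [exec]
    split_ifs with h
    · exact .inr ⟨_, _, _, _, rfl, fun e => by simpa [apply, h] using e⟩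
    · exact .inl rfl
  | cancel =>
    cases L with
    | nil => simp [exec]
    | cons a L =>
      cases R with
      | cons a' R => simp [exec]
      | nil =>
        cases T with
        | nil => simp [exec]
        | cons a' T =>
          simp only [exec, List.head?_cons, List.head?_nil]
          split_ifs with h
          · refine .inr ⟨_, _, _, _, rfl, fun e => ?_⟩
            obtain ⟨h, rfl⟩ := h
            obtain rfl : b = [] := h
            simp only [apply, List.tail_cons, List.append_nil] at e
            simp [e]
          · exact .inl rfl

/-- If the verifier accepts, the word on the first two stacks and in the buffer represents the same
element as the word on the third stack. -/
theorem run_instr_sound (c : List (Instr (Buffer A K))) (b : Buffer A K) (L R T : List A)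
    (h : (automaton g K).accepts ((automaton g K).run (conf K b L R T) (c.map .inr)) = true) :
    evalWord g (L.reverse ++ b.1 ++ R) = evalWord g T.reverse := by
  induction c generalizing b L R T with
  | nil =>
    simp [StackAutomaton.run, StackAutomaton.accepts, automaton] at h
    obtain ⟨⟨⟨h, rfl⟩, rfl⟩, rfl⟩ := h
    simp [h]
  | cons x c ih =>
    rcases step_sound g K b L R T x with h0 | ⟨b', L', R', T', h1, h2⟩
    · exact absurd (not_accepts_of_none g K h0 (c.map .inr)) (by
        simpa [StackAutomaton.run] using h)
    · refine h2 (ih b' L' R' T' ?_)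
      rw [← h1]
      exact h

/-- Soundness for the part of the input after the separator. -/
theorem run_second_sound (w : List (Option A)) (c : List (Instr (Buffer A K))) (L T : List A)
    (h : (automaton g K).accepts ((automaton g K).run (conf K (noBuffer K) L [] T)
      (w.map .inl ++ c.map .inr)) = true) :
    ∃ v : List A, w = v.map some ∧ evalWord g L.reverse = evalWord g (T.reverse ++ v) := by
  induction w generalizing T with
  | nil => exact ⟨[], rfl, by simpa [noBuffer] using run_instr_sound g K c _ L [] T h⟩
  | cons x w ih =>
    cases x with
    | none =>
      exact absurd (not_accepts_of_none g K
        (c := (automaton g K).step (conf K (noBuffer K) L [] T) (.inl none)) rfl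
        (w.map .inl ++ c.map .inr)) (by simpa [StackAutomaton.run] using h)
    | some a =>
      obtain ⟨v, rfl, e⟩ := ih (a :: T) h
      exact ⟨a :: v, rfl, by simpa using e⟩

/-- Soundness: an accepted input has the form `u # v` with `u = v` in `M`, where the letters of `u`
on the first stack have already been read. -/
theorem run_first_sound (w : List (Option A)) (c : List (Instr (Buffer A K))) (L : List A)
    (h : (automaton g K).accepts ((automaton g K).run ⟨some (false, noBuffer K), L, [], []⟩
      (w.map .inl ++ c.map .inr)) = true) :
    ∃ u v : List A, w = u.map some ++ [none] ++ v.map some ∧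
      evalWord g (L.reverse ++ u) = evalWord g v := by
  induction w generalizing L with
  | nil =>
    cases c with
    | nil => simp [StackAutomaton.run, StackAutomaton.accepts, automaton] at h
    | cons x c =>
      exact absurd (not_accepts_of_none g K
        (c := (automaton g K).step ⟨some (false, noBuffer K), L, [], []⟩ (.inr x)) rfl (c.map .inr))
        (by simpa [StackAutomaton.run] using h)
  | cons x w ih =>
    cases x with
    | none =>
      obtain ⟨v, rfl, e⟩ := run_second_sound g K w c L [] h
      exact ⟨[], v, rfl, by simpa using e⟩
    | some a =>
      obtain ⟨u, v, rfl, e⟩ := ih (a :: L) h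
      exact ⟨a :: u, v, rfl, by simpa using e⟩

/-! ### Completeness of the verifier -/

/-- Some sequence of at most `N` instructions leads from `c` to `c'`. -/
def Reaches (N : ℕ) (c c' : StackAutomaton.Config A (VerifierState A K)) : Prop :=
  ∃ x : List (Instr (Buffer A K)), x.length ≤ N ∧ (automaton g K).run c (x.map .inr) = c'

variable {g K}

theorem Reaches.refl (c : StackAutomaton.Config A (VerifierState A K)) : Reaches g K 0 c c :=
  ⟨[], le_rfl, rfl⟩

theorem Reaches.mono {N N' : ℕ} {c c' : StackAutomaton.Config A (VerifierState A K)}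
    (h : Reaches g K N c c') (hN : N ≤ N') : Reaches g K N' c c' :=
  h.imp fun _ h => ⟨h.1.trans hN, h.2⟩

theorem Reaches.trans {N N' : ℕ} {c c' c'' : StackAutomaton.Config A (VerifierState A K)}
    (h : Reaches g K N c c') (h' : Reaches g K N' c' c'') : Reaches g K (N + N') c c'' := by
  obtain ⟨x, hx, rfl⟩ := h
  obtain ⟨y, hy, rfl⟩ := h'
  exact ⟨x ++ y, by simp; omega, by simp [StackAutomaton.run]⟩

theorem Reaches.single {c c' : StackAutomaton.Config A (VerifierState A K)}
    (x : Instr (Buffer A K)) (h : (automaton g K).step c (.inr x) = c') : Reaches g K 1 c c' :=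
  ⟨[x], le_rfl, h⟩

theorem reaches_toRight (y L R T : List A) : Reaches g K y.length
    (conf K (noBuffer K) (y.reverse ++ L) R T) (conf K (noBuffer K) L (y ++ R) T) := by
  induction y using List.reverseRecOn generalizing R with
  | nil => exact .refl _
  | append_singleton y a ih =>
    have h1 : Reaches g K 1 (conf K (noBuffer K) (a :: (y.reverse ++ L)) R T)
        (conf K (noBuffer K) (y.reverse ++ L) (a :: R) T) := .single .toRight (by
      simp [StackAutomaton.step, automaton, exec, noBuffer, apply])
    simpa [add_comm] using h1.trans (ih (a :: R))

theorem reaches_toLeft (y L R T : List A) : Reaches g K y.length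
    (conf K (noBuffer K) L (y ++ R) T) (conf K (noBuffer K) (y.reverse ++ L) R T) := by
  induction y generalizing L with
  | nil => exact .refl _
  | cons a y ih =>
    have h1 : Reaches g K 1 (conf K (noBuffer K) L (a :: (y ++ R)) T)
        (conf K (noBuffer K) (a :: L) (y ++ R) T) := .single .toLeft (by
      simp [StackAutomaton.step, automaton, exec, noBuffer, apply])
    simpa [add_comm] using h1.trans (ih (a :: L))

theorem reaches_absorb (y b L R T : List A) (h : (y ++ b).length ≤ K) : Reaches g K y.length
    (conf K ⟨b, by simp at h; omega⟩ (y.reverse ++ L) R T) (conf K ⟨y ++ b, h⟩ L R T) := by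
  induction y using List.reverseRecOn generalizing b with
  | nil => exact .refl _
  | append_singleton y a ih =>
    have h' : (y ++ a :: b).length ≤ K := by simpa using h
    have hb : (a :: b).length ≤ K := by simp at h' ⊢; omega
    have h1 : Reaches g K 1
        (conf K ⟨b, (Nat.le_succ _).trans hb⟩ (a :: (y.reverse ++ L)) R T)
        (conf K ⟨a :: b, hb⟩ (y.reverse ++ L) R T) := .single .absorb (by
      simp [StackAutomaton.step, automaton, exec, withBuffer, apply, Nat.lt_of_succ_le hb])
    simpa [add_comm] using h1.trans (ih (a :: b) h')

theorem reaches_emit (b L R T : List A) (h : b.length ≤ K) : Reaches g K b.length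
    (conf K ⟨b, h⟩ L R T) (conf K (noBuffer K) (b.reverse ++ L) R T) := by
  induction b generalizing L with
  | nil => exact .refl _
  | cons a b ih =>
    have h' : b.length ≤ K := (Nat.le_succ _).trans h
    have h1 : Reaches g K 1 (conf K ⟨a :: b, h⟩ L R T) (conf K ⟨b, h'⟩ (a :: L) R T) :=
      .single .emit (by simp [StackAutomaton.step, automaton, exec, withBuffer, apply, h'])
    simpa [add_comm] using h1.trans (ih (a :: L) h')

theorem reaches_cancel (L : List A) :
    Reaches g K L.length (conf K (noBuffer K) L [] L) (conf K (noBuffer K) [] [] []) := by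
  induction L with
  | nil => exact .refl _
  | cons a L ih =>
    refine ((Reaches.single .cancel ?_).trans ih).mono (by simp; omega)
    simp [StackAutomaton.step, automaton, exec, noBuffer, apply]

/-- The word `u` on the first stack and the word `v` on the third. -/
abbrev wordConf (K : ℕ) (u v : List A) : StackAutomaton.Config A (VerifierState A K) :=
  conf K (noBuffer K) u.reverse [] v.reverse

/-- One application of a relation is simulated by moving the subword to be replaced into the
buffer. -/
theorem reaches_of_relationStep {u v : List A} (h : RelationStep (shortRelations g K) u v)
    (t : List A) : v.length ≤ u.length + K ∧
      Reaches g K (2 * u.length + K + 1) (wordConf K u t) (wordConf K v t) := by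
  obtain ⟨x, y, l, r, h, rfl, rfl⟩ := h
  obtain ⟨hl, hr, e⟩ : l.length ≤ K ∧ r.length ≤ K ∧ evalWord g l = evalWord g r := by
    rcases h with h | h
    · exact h
    · exact ⟨h.2.1, h.1, h.2.2.symm⟩
  refine ⟨by simp; omega, ?_⟩
  have h1 := reaches_toRight (g := g) (K := K) y (l.reverse ++ x.reverse) [] t.reverse
  have h2 := reaches_absorb (g := g) (K := K) l [] x.reverse y t.reverse (by simpa using hl)
  have h3 : Reaches g K 1 (conf K ⟨l, hl⟩ x.reverse y t.reverse)
      (conf K ⟨r, hr⟩ x.reverse y t.reverse) := .single (.replace ⟨r, hr⟩) (by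
    simp [StackAutomaton.step, automaton, exec, apply, e])
  have h4 := reaches_emit (g := g) (K := K) r x.reverse y t.reverse hr
  have h5 := reaches_toLeft (g := g) (K := K) y (r.reverse ++ x.reverse) [] t.reverse
  simp only [List.append_nil] at h1 h2 h5
  have := (((h1.trans h2).trans h3).trans h4).trans h5
  simp only [wordConf, List.reverse_append]
  exact this.mono (by simp; omega)

/-- A derivation of length `k` from `u` is simulated: the words in it are no longer than
`|u| + k K`, which bounds the number of cursor movements for each relation. -/
theorem reaches_of_derivesIn {u v : List A} {k : ℕ} (h : DerivesIn (shortRelations g K) k u v)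
    (t : List A) : Reaches g K (k * (2 * (u.length + k * K) + K + 1))
      (wordConf K u t) (wordConf K v t) := by
  obtain ⟨f, rfl, rfl, h⟩ := h
  have hlen : ∀ i ≤ k, (f i).length ≤ (f 0).length + i * K := by
    intro i
    induction i with
    | zero => simp
    | succ i ih =>
      intro hi
      have := (reaches_of_relationStep (h i hi) t).1
      have := ih (by omega)
      lia
  have key : ∀ i ≤ k, Reaches g K (i * (2 * ((f 0).length + k * K) + K + 1))
      (wordConf K (f 0) t) (wordConf K (f i) t) := by
    intro i
    induction i with
    | zero => exact fun _ => (Reaches.refl _).mono (Nat.zero_le _)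
    | succ i ih =>
      intro hi
      refine ((ih (by omega)).trans (reaches_of_relationStep (h i hi) t).2).mono ?_
      have h1 := hlen i (by omega)
      have h2 : i * K ≤ k * K := Nat.mul_le_mul_right K (by omega)
      lia
  exact key k le_rfl

/-- Reading `u # v` puts `u` on the first stack and `v` on the third. -/
theorem run_word (u v : List A) :
    (automaton g K).run (automaton g K).init ((u.map some ++ [none] ++ v.map some).map .inl) =
      wordConf K u v := by
  have h1 : ∀ (L : List A) (u : List A), (automaton g K).run ⟨some (false, noBuffer K), L, [], []⟩
      ((u.map some).map .inl) = ⟨some (false, noBuffer K), u.reverse ++ L, [], []⟩ := by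
    intro L u
    induction u generalizing L with
    | nil => rfl
    | cons a u ih => exact (ih (a :: L)).trans (by simp)
  have h2 : ∀ (L T : List A) (v : List A), (automaton g K).run (conf K (noBuffer K) L [] T)
      ((v.map some).map .inl) = conf K (noBuffer K) L [] (v.reverse ++ T) := by
    intro L T v
    induction v generalizing T with
    | nil => rfl
    | cons a v ih => exact (ih (a :: T)).trans (by simp)
  have h3 := h1 [] u
  have h4 := h2 u.reverse [] v
  simp only [StackAutomaton.run, List.append_nil] at h3 h4 ⊢
  rw [List.map_append, List.map_append, List.foldl_append, List.foldl_append]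
  have h5 : (automaton g K).init = ⟨some (false, noBuffer K), [], [], []⟩ := rfl
  rw [h5, h3]
  exact h4

end Verifier

/-- A polynomial bound on the Dehn function puts the word problem in NP, with derivations as
certificates. -/
theorem inNP_wordProblem {M : Type*} [Monoid M] {A : Type} [Finite A] (g : A → M) (K : ℕ)
    (P : Polynomial ℕ) (hR : IsMonoidPresentation g (shortRelations g K))
    (hP : DehnFunctionLE (shortRelations g K) (fun m => P.eval m)) :
    InNP (wordProblem g) := by
  have : Finite (Buffer A K) := (List.finite_length_le A K).to_subtype
  have : Finite (Option A ⊕ Instr (Buffer A K)) := inferInstance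
  refine ⟨Instr (Buffer A K), inferInstance, _,
    P * (2 * (Polynomial.X + P * Polynomial.C K) + Polynomial.C K + 1) + Polynomial.X,
    (Verifier.automaton g K).computableInPolyTime _, fun w => ⟨?_, ?_⟩⟩
  · rintro ⟨u, v, rfl, e⟩
    set N := (u.map some ++ [none] ++ v.map some).length with hN
    have hN' : N = u.length + 1 + v.length := by simp [hN]; omega
    obtain ⟨k, hk, hd⟩ := hP N u v ((hR.eq_iff u v).1 e) (by omega)
    have h1 := (Verifier.reaches_of_derivesIn hd v).trans (Verifier.reaches_cancel v.reverse)
    obtain ⟨x, hx, hr⟩ := h1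
    refine ⟨x, hx.trans ?_, ?_⟩
    · simp only [Polynomial.eval_add, Polynomial.eval_mul, Polynomial.eval_X, Polynomial.eval_C,
        Polynomial.eval_ofNat, Polynomial.eval_one, List.length_reverse]
      have : k * (2 * (u.length + k * K) + K + 1) ≤
          P.eval N * (2 * (N + P.eval N * K) + K + 1) := by
        have : u.length ≤ N := by omega
        gcongr
      omega
    · have h2 : (Computability.encodingProd (Computability.encodingList (Option A))
          (Computability.encodingList (Instr (Buffer A K)))).encode
          (u.map some ++ [none] ++ v.map some, x) =
          (u.map some ++ [none] ++ v.map some).map .inl ++ x.map .inr := rfl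
      have h3 := Verifier.run_word (g := g) (K := K) u v
      rw [h2, StackAutomaton.run, List.foldl_append]
      rw [StackAutomaton.run] at h3 hr
      rw [h3, hr]
      rfl
  · rintro ⟨c, -, h⟩
    obtain ⟨u, v, e, h⟩ := Verifier.run_first_sound g K w c [] h
    exact ⟨u, v, e, h⟩

theorem mainTheorem2 {M : Type*} [Monoid M] [IsLeftCancelMul M] (δ : ℝ≥0)
    (S : Set M) (hfin : S.Finite) (hgen : Submonoid.closure S = ⊤)
    (hS : (rightCayleyGraph S).StronglyHyperbolic δ)
    (n : ℕ) (g : Fin n → M) (hg : Submonoid.closure (Set.range g) = ⊤) :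
    (∃ (R : Set (List (Fin n) × List (Fin n))) (p : Polynomial ℕ), R.Finite ∧
      IsMonoidPresentation g R ∧ DehnFunctionLE R (fun m => p.eval m)) ∧
    InNP (wordProblem g) := by
  obtain ⟨K, P, hR, hP⟩ := hS.thinWords.exists_presentation hfin hgen g hg
  exact ⟨⟨_, P, finite_shortRelations g K, hR, hP⟩, inNP_wordProblem g K P hR hP⟩
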